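/- \textbf{Theorem (the rewriting system FS is terminating).} \emph{Hypergraphs.} Let $\Sigma=\{\mu\colon 2\to 1,\ \delta\colon 1\to 2\}$. A $\Sigma$-hypergraph $G$ consists of a finite set of nodes and finitely many hyperedges, each labelled by $\mu$ (two ordered source nodes, one target node) or by $\delta$ (one source node, two ordered target nodes). Homomorphisms preserve labels, ordered sources and ordered targets. A natural number $n$ is regarded as the discrete hypergraph with $n$ nodes and no hyperedges. A cospan $n\xrightarrow{f}G\xleftarrow{g}m$ is \emph{monogamous} if $f,g$ are mono, every node in the image of $f$ has in-degree $0$ and every other node has in-degree $1$, and every node in the image of $g$ has out-degree $0$ and every other node has out-degree $1$. A \emph{path} from a node $v$ to a node $w$ is a nonempty list of hyperedges such that $v$ is a source of the first one, $w$ is a target of the last one, and each hyperedge other than the last has a target that is a source of the next one. A sub-hypergraph $H\subseteq G$ is \emph{convex} if every hyperedge of every path in $G$ between two nodes of $H$ lies in $H$. A \emph{convex matching} is a mono $L\to G$ whose image is convex. \emph{Convex double-pushout rewriting with interfaces.} Let $\mathcal R$ be a set of rules $L\xleftarrow{[a_1,a_2]}i+j\xrightarrow{[b_1,b_2]}R$.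 For hypergraphs with interface $D\xleftarrow{[q_1,q_2]}n+m$ and $E\xleftarrow{[p_1,p_2]}n+m$, we say that $D$ rewrites convexly into $E$ if there are a rule as above, a hypergraph $C$ and morphisms $i+j\xrightarrow{[c_1,c_2]}C\xleftarrow{[d_1,d_2]}n+m$, $f\colon L\to D$, $R\to E$, $C\to D$, $C\to E$ such that the squares $(i+j,L,C,D)$ and $(i+j,R,C,E)$ are pushouts, the composites $n+m\to C\to D$ and $n+m\to C\to E$ are the given interfaces, $f$ is a convex matching, and $C$ is a boundary complement: the cospans $i\to L\leftarrow j$ and $n\to D\leftarrow m$ are monogamous, $[c_1,c_2]$ is mono, and $j+n\xrightarrow{[c_2,d_1]}C\xleftarrow{[c_1,d_2]}m+i$ is monogamous. \emph{The system FS.} It consists of the following four rules, each term standing for the corresponding hypergraph with its inputs and outputs as interface: \begin{align*} \text{associativity:}\quad & (\mu\oplus \mathrm{id})\,;\,\mu\ \Rightarrow\ (\mathrm{id}\oplus\mu)\,;\,\mu, & \text{Frobenius:}\quad & (\delta\oplus \mathrm{id})\,;\,(\mathrm{id}\oplus\mu)\ \Rightarrow\ \mu\,;\,\delta,\\ \text{coassociativity:}\quad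 & \delta\,;\,(\delta\oplus \mathrm{id})\ \Rightarrow\ \delta\,;\,(\mathrm{id}\oplus\delta), & & (\mathrm{id}\oplus\delta)\,;\,(\mu\oplus \mathrm{id})\ \Rightarrow\ \mu\,;\,\delta . \end{align*} \emph{Claim.} FS is terminating: for all $n,m\in\mathbb N$ there is no infinite sequence $G_0,G_1,G_2,\dots$ of $\Sigma$-hypergraphs with interface $n+m$ such that $G_t$ rewrites convexly into $G_{t+1}$ by a rule of FS for every $t\in\mathbb N$. -/

import Mathlib

open CategoryTheory

/-- A (one-sorted) monoidal signature: operations `o : ar o → coar o`. -/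
structure MonoidalSignature where
  Op : Type
  ar : Op → ℕ
  coar : Op → ℕ

/-- A finite directed hypergraph labelled in the signature `S`. The labelling map to the one-node
hypergraph of `S`-operations is recorded by its fibres: `E o` is the set of hyperedges labelled by
the operation `o`; such a hyperedge has `ar o` ordered sources and `coar o` ordered targets. -/
structure SigHypergraph (S : MonoidalSignature) where
  V : Type
  E : S.Op → Type
  src : ∀ o, E o → Fin (S.ar o) → V
  tgt : ∀ o, E o → Fin (S.coar o) → V
  finite_V : Finite V
  finite_E : Finite (Σ o, E o)

namespace SigHypergraph

variable {S : MonoidalSignature}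

attribute [instance] SigHypergraph.finite_V SigHypergraph.finite_E

/-- Label-preserving hypergraph homomorphisms. -/
@[ext]
structure Hom (G H : SigHypergraph S) where
  vmap : G.V → H.V
  emap : ∀ o, G.E o → H.E o
  map_src : ∀ o e i, vmap (G.src o e i) = H.src o (emap o e) i
  map_tgt : ∀ o e i, vmap (G.tgt o e i) = H.tgt o (emap o e) i

/-- The category of finite `S`-labelled hypergraphs. -/
instance : Category (SigHypergraph S) where
  Hom := Hom
  id G :=
    { vmap := id
      emap := fun _ => id
      map_src := fun _ _ _ => rfl
      map_tgt := fun _ _ _ => rfl }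
  comp f g :=
    { vmap := g.vmap ∘ f.vmap
      emap := fun o => g.emap o ∘ f.emap o
      map_src := fun o e i => by simp [f.map_src, g.map_src]
      map_tgt := fun o e i => by simp [f.map_tgt, g.map_tgt] }

/-- All hyperedges of `G`, each with its label. -/
abbrev Hyperedge (G : SigHypergraph S) : Type := Σ o, G.E o

/-- `v` is one of the sources of `h`. -/
def IsSource (G : SigHypergraph S) (v : G.V) (h : G.Hyperedge) : Prop :=
  ∃ i, G.src h.1 h.2 i = v

/-- `v` is one of the targets of `h`. -/
def IsTarget (G : SigHypergraph S) (v : G.V) (h : G.Hyperedge) : Prop :=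
  ∃ i, G.tgt h.1 h.2 i = v

/-- `h'` is a successor of `h`: some node is a target of `h` and a source of `h'`. -/
def Successor (G : SigHypergraph S) (h h' : G.Hyperedge) : Prop :=
  ∃ v, G.IsTarget v h ∧ G.IsSource v h'

/-- The list `p` of hyperedges is a (nonempty, directed) path from the node `v` to the node `w`. -/
def IsPath (G : SigHypergraph S) (v w : G.V) (p : List G.Hyperedge) : Prop :=
  p.IsChain G.Successor ∧ (∃ h ∈ p.head?, G.IsSource v h) ∧ (∃ h ∈ p.getLast?, G.IsTarget w h)

/-- A sub-hypergraph: sets of nodes and hyperedges closed under sources and targets. -/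
structure Sub (G : SigHypergraph S) where
  nodes : Set G.V
  edges : Set G.Hyperedge
  src_mem : ∀ h ∈ edges, ∀ v, G.IsSource v h → v ∈ nodes
  tgt_mem : ∀ h ∈ edges, ∀ v, G.IsTarget v h → v ∈ nodes

/-- A sub-hypergraph is convex if it contains every hyperedge of every path of `G` that leads from
one of its nodes to one of its nodes. -/
def Sub.IsConvex {G : SigHypergraph S} (H : G.Sub) : Prop :=
  ∀ v ∈ H.nodes, ∀ w ∈ H.nodes, ∀ p, G.IsPath v w p → ∀ h ∈ p, h ∈ H.edges

/-- The image of a homomorphism. -/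
def image {G H : SigHypergraph S} (f : G ⟶ H) : H.Sub where
  nodes := Set.range f.vmap
  edges := Set.range fun h : G.Hyperedge => (⟨h.1, f.emap h.1 h.2⟩ : H.Hyperedge)
  src_mem := by
    rintro _ ⟨h, rfl⟩ v ⟨i, rfl⟩
    exact ⟨G.src h.1 h.2 i, f.map_src h.1 h.2 i⟩
  tgt_mem := by
    rintro _ ⟨h, rfl⟩ v ⟨i, rfl⟩
    exact ⟨G.tgt h.1 h.2 i, f.map_tgt h.1 h.2 i⟩

/-- A convex matching: a mono with convex image. -/
def IsConvexMatching {L G : SigHypergraph S} (f : L ⟶ G) : Prop :=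
  Mono f ∧ (image f).IsConvex

/-- The number of pairs `(h, i)` such that `v` is the `i`-th target of `h`. -/
noncomputable def inDegree (G : SigHypergraph S) (v : G.V) : ℕ :=
  Set.ncard {p : Σ h : G.Hyperedge, Fin (S.coar h.1) | G.tgt p.1.1 p.1.2 p.2 = v}

/-- The number of pairs `(h, i)` such that `v` is the `i`-th source of `h`. -/
noncomputable def outDegree (G : SigHypergraph S) (v : G.V) : ℕ :=
  Set.ncard {p : Σ h : G.Hyperedge, Fin (S.ar h.1) | G.src p.1.1 p.1.2 p.2 = v}

/-- The discrete hypergraph on a finite set of nodes. The coproduct of the interfaces `n` and `m`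
is represented by `discrete S (Fin n ⊕ Fin m)`. -/
abbrev discrete (S : MonoidalSignature) (X : Type) [Finite X] : SigHypergraph S where
  V := X
  E := fun _ => Empty
  src := fun _ e => e.elim
  tgt := fun _ e => e.elim
  finite_V := inferInstance
  finite_E :=
    haveI : IsEmpty (Σ _ : S.Op, Empty) := ⟨fun x => x.2.elim⟩
    inferInstance

/-- The homomorphism out of a discrete hypergraph given by its action on nodes. -/
def ofDiscrete {X : Type} [Finite X] {G : SigHypergraph S} (v : X → G.V) : discrete S X ⟶ G :=
  Hom.mk v (fun _ e => e.elim) (fun _ e => e.elim) (fun _ e => e.elim)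

/-- Monogamy of a cospan `X → G ← Y` with discrete feet. -/
structure IsMonogamous {X Y : Type} [Finite X] [Finite Y] {G : SigHypergraph S}
    (f : discrete S X ⟶ G) (g : discrete S Y ⟶ G) : Prop where
  mono_left : Mono f
  mono_right : Mono g
  inDegree_input : ∀ v ∈ Set.range f.vmap, G.inDegree v = 0
  inDegree_other : ∀ v ∉ Set.range f.vmap, G.inDegree v = 1
  outDegree_output : ∀ v ∈ Set.range g.vmap, G.outDegree v = 0
  outDegree_other : ∀ v ∉ Set.range g.vmap, G.outDegree v = 1

section Legs

variable {X Y : Type} [Finite X] [Finite Y] {G : SigHypergraph S}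

/-- The component `a₁` of `a = [a₁, a₂]`. -/
def leg₁ (a : discrete S (X ⊕ Y) ⟶ G) : discrete S X ⟶ G := ofDiscrete fun x => a.vmap (Sum.inl x)

/-- The component `a₂` of `a = [a₁, a₂]`. -/
def leg₂ (a : discrete S (X ⊕ Y) ⟶ G) : discrete S Y ⟶ G := ofDiscrete fun y => a.vmap (Sum.inr y)

/-- The copairing `[f, g]`. -/
def copair (f : discrete S X ⟶ G) (g : discrete S Y ⟶ G) : discrete S (X ⊕ Y) ⟶ G :=
  ofDiscrete (Sum.elim f.vmap g.vmap)

end Legs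

/-- Given `a : i + j → L`, `b : n + m → G` whose underlying cospans are monogamous, and a mono
`f : L → G`, the data `i + j --c--> C --g--> G`, `d : n + m → C` form a boundary complement. -/
structure IsBoundaryComplement {i j n m : ℕ} {L G C : SigHypergraph S}
    (a : discrete S (Fin i ⊕ Fin j) ⟶ L) (f : L ⟶ G) (b : discrete S (Fin n ⊕ Fin m) ⟶ G)
    (c : discrete S (Fin i ⊕ Fin j) ⟶ C) (g : C ⟶ G) (d : discrete S (Fin n ⊕ Fin m) ⟶ C) :
    Prop where
  monogamous_pattern : IsMonogamous (leg₁ a) (leg₂ a)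
  monogamous_target : IsMonogamous (leg₁ b) (leg₂ b)
  mono_match : Mono f
  isPushout : IsPushout a c f g
  mono_boundary : Mono c
  interface_comm : d ≫ g = b
  monogamous_complement :
    IsMonogamous (copair (leg₂ c) (leg₁ d)) (copair (leg₁ c) (leg₂ d))

end SigHypergraph

open SigHypergraph

/-- A hypergraph with interface, `G ← n + m`. -/
structure InterfacedHypergraph (S : MonoidalSignature) (n m : ℕ) where
  graph : SigHypergraph S
  interface : discrete S (Fin n ⊕ Fin m) ⟶ graph

/-- A DPO rule `L ← i + j → R`. -/
structure DPORule (S : MonoidalSignature) where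
  i : ℕ
  j : ℕ
  L : SigHypergraph S
  R : SigHypergraph S
  left : discrete S (Fin i ⊕ Fin j) ⟶ L
  right : discrete S (Fin i ⊕ Fin j) ⟶ R

/-- One step of convex double-pushout rewriting with interface `n + m`. -/
def ConvexRewrites {S : MonoidalSignature} (𝓡 : Set (DPORule S)) {n m : ℕ}
    (D E : InterfacedHypergraph S n m) : Prop :=
  ∃ ρ ∈ 𝓡, ∃ (C : SigHypergraph S) (f : ρ.L ⟶ D.graph) (c : discrete S (Fin ρ.i ⊕ Fin ρ.j) ⟶ C)
    (g : C ⟶ D.graph) (r : ρ.R ⟶ E.graph) (k : C ⟶ E.graph)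
    (d : discrete S (Fin n ⊕ Fin m) ⟶ C),
    IsConvexMatching f ∧
    IsBoundaryComplement ρ.left f D.interface c g d ∧
    IsPushout ρ.right c r k ∧
    d ≫ k = E.interface

/-- A relation is terminating if it admits no infinite sequence of steps. -/
def IsTerminating {α : Type*} (r : α → α → Prop) : Prop :=
  ¬ ∃ x : ℕ → α, ∀ t, r (x t) (x (t + 1))

namespace FrobeniusSemialgebra

/-- The two generators of Frobenius semi-algebras. -/
inductive Gen
  | mu
  | delta

/-- The signature `{μ : 2 → 1, δ : 1 → 2}`. -/
abbrev sig : MonoidalSignature where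
  Op := Gen
  ar := fun
    | .mu => 2
    | .delta => 1
  coar := fun
    | .mu => 1
    | .delta => 2

/-- The hypergraph with nodes `0, …, k - 1`, with a `μ`-hyperedge with sources `x, y` and target `z`
for each entry `(x, y, z)` of `mus`, and with a `δ`-hyperedge with source `x` and targets `y, z`
for each entry `(x, y, z)` of `deltas`. -/
def graph (k : ℕ) {p q : ℕ} (mus : Fin p → Fin k × Fin k × Fin k)
    (deltas : Fin q → Fin k × Fin k × Fin k) : SigHypergraph sig where
  V := Fin k
  E := fun
    | .mu => Fin p
    | .delta => Fin q
  src := fun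
    | .mu => fun e => ![(mus e).1, (mus e).2.1]
    | .delta => fun e => ![(deltas e).1]
  tgt := fun
    | .mu => fun e => ![(mus e).2.2]
    | .delta => fun e => ![(deltas e).2.1, (deltas e).2.2]
  finite_V := inferInstanceAs (Finite (Fin k))
  finite_E := by
    refine Finite.of_surjective
      (Sum.elim (fun e : Fin p => ⟨Gen.mu, e⟩) (fun e : Fin q => ⟨Gen.delta, e⟩)) ?_
    rintro ⟨_ | _, e⟩
    · exact ⟨Sum.inl e, rfl⟩
    · exact ⟨Sum.inr e, rfl⟩

/-- The interface `i + j → G` picking out the given nodes as inputs and outputs, in order. -/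
def boundary {k p q : ℕ} {mus : Fin p → Fin k × Fin k × Fin k}
    {deltas : Fin q → Fin k × Fin k × Fin k} {i j : ℕ} (ins : Fin i → Fin k) (outs : Fin j → Fin k) :
    discrete sig (Fin i ⊕ Fin j) ⟶ graph k mus deltas :=
  ofDiscrete (G := graph k mus deltas) (Sum.elim ins outs)

/-- Associativity, `μ(μ(x₀, x₁), x₂) ⟹ μ(x₀, μ(x₁, x₂))`; inputs `0, 1, 2`, output `3`. -/
def assoc : DPORule sig where
  i := 3
  j := 1
  L := graph 5 ![(0, 1, 4), (4, 2, 3)] ![]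
  R := graph 5 ![(1, 2, 4), (0, 4, 3)] ![]
  left := boundary ![0, 1, 2] ![3]
  right := boundary ![0, 1, 2] ![3]

/-- Coassociativity, `δ ; (δ ⊕ id) ⟹ δ ; (id ⊕ δ)`; input `0`, outputs `1, 2, 3`. -/
def coassoc : DPORule sig where
  i := 1
  j := 3
  L := graph 5 ![] ![(0, 4, 3), (4, 1, 2)]
  R := graph 5 ![] ![(0, 1, 4), (4, 2, 3)]
  left := boundary ![0] ![1, 2, 3]
  right := boundary ![0] ![1, 2, 3]

/-- First Frobenius rule, `(δ ⊕ id) ; (id ⊕ μ) ⟹ μ ; δ`; inputs `0, 1`, outputs `2, 3`. -/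
def frob₁ : DPORule sig where
  i := 2
  j := 2
  L := graph 5 ![(4, 1, 3)] ![(0, 2, 4)]
  R := graph 5 ![(0, 1, 4)] ![(4, 2, 3)]
  left := boundary ![0, 1] ![2, 3]
  right := boundary ![0, 1] ![2, 3]

/-- Second Frobenius rule, `(id ⊕ δ) ; (μ ⊕ id) ⟹ μ ; δ`; inputs `0, 1`, outputs `2, 3`. -/
def frob₂ : DPORule sig where
  i := 2
  j := 2
  L := graph 5 ![(0, 4, 2)] ![(1, 4, 3)]
  R := graph 5 ![(0, 1, 4)] ![(4, 2, 3)]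
  left := boundary ![0, 1] ![2, 3]
  right := boundary ![0, 1] ![2, 3]

/-- The rewriting system for Frobenius semi-algebras. -/
def FS : Set (DPORule sig) := {assoc, coassoc, frob₁, frob₂}

end FrobeniusSemialgebra

/-! Termination follows from a weight in `ℕ ×ₗ ℕ` that drops at every step. A pair of hyperedges is
linked if a directed path, possibly empty, leads from the first target of the one to the first
source of the other. The weight counts the unlinked (`μ`, `δ`) pairs and then the linked pairs with
equal labels. No rule changes the number of `μ`s or of `δ`s. A Frobenius step preserves all links
from a `μ` to a `δ` and creates a new one, since convexity excludes a path in the host from an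
output of the pattern back to an input. (Co)associativity loses no such link. As only first sources
and first targets count, reassociating to the right destroys the link between its two hyperedges and
creates none of equal label. All this reduces to finite checks on the patterns. A pushout along
injective legs is a union of pattern and context meeting in the interface (`isGluing_of_isPushout`),
so a path in it splits into pieces, and those in the pattern can be replaced
(`Simulates.linked_mono`). `not_reach_of_isConvex_image` gives strictness. -/

namespace SigHypergraph

variable {S : MonoidalSignature}

/-! ### Reachability and convexity -/

/-- Some hyperedge has `v` as a source and `w` as a target. -/
def Step (G : SigHypergraph S) (v w : G.V) : Prop :=
  ∃ h, G.IsSource v h ∧ G.IsTarget w h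

/-- There is a possibly empty directed path from `v` to `w`. -/
def Reach (G : SigHypergraph S) : G.V → G.V → Prop :=
  Relation.ReflTransGen G.Step

theorem Step.map {G H : SigHypergraph S} (f : G ⟶ H) {v w : G.V} (h : G.Step v w) :
    H.Step (f.vmap v) (f.vmap w) := by
  obtain ⟨⟨o, e⟩, ⟨i, rfl⟩, ⟨j, rfl⟩⟩ := h
  exact ⟨⟨o, f.emap o e⟩, ⟨i, (f.map_src o e i).symm⟩, ⟨j, (f.map_tgt o e j).symm⟩⟩

theorem Reach.map {G H : SigHypergraph S} (f : G ⟶ H) {v w : G.V} (h : G.Reach v w) :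
    H.Reach (f.vmap v) (f.vmap w) :=
  Relation.ReflTransGen.lift (p := H.Step) f.vmap (fun _ _ => Step.map f) _ _ h

theorem exists_isPath_of_transGen {G : SigHypergraph S} {v w : G.V}
    (h : Relation.TransGen G.Step v w) : ∃ p, G.IsPath v w p := by
  induction h using Relation.TransGen.head_induction_on with
  | single h =>
    obtain ⟨e, hs, ht⟩ := h
    exact ⟨[e], by simp, ⟨e, by simp, hs⟩, ⟨e, by simp, ht⟩⟩
  | head h _ ih =>
    obtain ⟨e, hs, ht⟩ := h
    obtain ⟨p, hp, ⟨h₁, hh₁, hs₁⟩, ⟨h₂, hh₂, ht₂⟩⟩ := ih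
    refine ⟨e :: p, ?_, ⟨e, by simp, hs⟩, ⟨h₂, ?_, ht₂⟩⟩
    · rw [List.isChain_cons]
      refine ⟨fun y hy => ?_, hp⟩
      obtain rfl : y = h₁ := Option.mem_unique hy hh₁
      exact ⟨_, ht, hs₁⟩
    · cases p with
      | nil => simp at hh₁
      | cons a l => simpa using hh₂

/-- A convex matching creates no path out of a node which is a sink of the pattern. -/
theorem not_reach_of_isConvex_image {L G : SigHypergraph S} {f : L ⟶ G}
    (hinj : Function.Injective f.vmap) (hf : (image f).IsConvex) {x y : L.V} (hxy : x ≠ y)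
    (hx : ∀ h, ¬ L.IsSource x h) : ¬ G.Reach (f.vmap x) (f.vmap y) := by
  intro h
  rcases Relation.reflTransGen_iff_eq_or_transGen.1 h with h | h
  · exact hxy (hinj h.symm)
  obtain ⟨p, hp⟩ := exists_isPath_of_transGen h
  obtain ⟨e, he, hs⟩ := hp.2.1
  -- By convexity the first hyperedge of the path comes from the pattern, where it would leave the
  -- sink `x`.
  obtain ⟨⟨o, d⟩, rfl⟩ := hf _ ⟨x, rfl⟩ _ ⟨y, rfl⟩ p hp e (List.mem_of_mem_head? he)
  obtain ⟨i, hi⟩ := hs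
  exact hx ⟨o, d⟩ ⟨i, hinj ((f.map_src o d i).trans hi)⟩

/-- The one-node discrete hypergraph separates nodes. -/
theorem injective_of_mono {X : Type} [Finite X] {G : SigHypergraph S} (f : discrete S X ⟶ G)
    [Mono f] : Function.Injective f.vmap := by
  intro x y h
  have := (cancel_mono f).1 (show ofDiscrete (G := discrete S X) (fun _ : Unit => x) ≫ f =
    ofDiscrete (G := discrete S X) (fun _ : Unit => y) ≫ f from
      Hom.ext (funext fun _ => h) (funext fun _ => funext fun e => e.elim))
  exact congrFun (congrArg Hom.vmap this) ()

/-! ### Pushouts as gluings -/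

/-- `G` is the union of the images of `L` and `C`, which overlap exactly in the interface `X`. -/
structure IsGluing {X : Type} [Finite X] {L C G : SigHypergraph S} (a : discrete S X ⟶ L)
    (c : discrete S X ⟶ C) (f : L ⟶ G) (g : C ⟶ G) : Prop where
  left_injective : Function.Injective f.vmap
  right_injective : Function.Injective g.vmap
  glue : ∀ i, f.vmap (a.vmap i) = g.vmap (c.vmap i)
  overlap : ∀ x v, f.vmap x = g.vmap v → ∃ i, a.vmap i = x ∧ c.vmap i = v
  bijective : ∀ o, Function.Bijective (Sum.elim (f.emap o) (g.emap o))

section Pushout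

variable {X : Type} [Finite X] {L C G : SigHypergraph S}

/-- The pushout of `L ← X → C` along a leg `a` injective on nodes. -/
def amalgam (a : discrete S X ⟶ L) (C : SigHypergraph S) (φ : L.V → C.V ⊕ ↥(Set.range a.vmap)ᶜ) :
    SigHypergraph S where
  V := C.V ⊕ ↥(Set.range a.vmap)ᶜ
  E o := L.E o ⊕ C.E o
  src o := Sum.elim (fun e i => φ (L.src o e i)) (fun e i => Sum.inl (C.src o e i))
  tgt o := Sum.elim (fun e i => φ (L.tgt o e i)) (fun e i => Sum.inl (C.tgt o e i))
  finite_V := inferInstance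
  finite_E := Finite.of_surjective
    (Sum.elim (fun h : L.Hyperedge => ⟨h.1, Sum.inl h.2⟩) (fun h : C.Hyperedge => ⟨h.1, Sum.inr h.2⟩))
    (by
      rintro ⟨o, e | e⟩
      · exact ⟨Sum.inl ⟨o, e⟩, rfl⟩
      · exact ⟨Sum.inr ⟨o, e⟩, rfl⟩)

/-- The sub-hypergraph covered by two homomorphisms. -/
def union (f : L ⟶ G) (g : C ⟶ G) : SigHypergraph S where
  V := G.V
  E o := ↥(Set.range (f.emap o) ∪ Set.range (g.emap o))
  src o e := G.src o e.1
  tgt o e := G.tgt o e.1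
  finite_V := inferInstance
  finite_E := Finite.of_injective (β := G.Hyperedge) (fun h => ⟨h.1, h.2.1⟩) (by
    rintro ⟨o, e, he⟩ ⟨o', e', he'⟩ h
    simp only [Sigma.mk.injEq] at h
    obtain ⟨rfl, h⟩ := h
    obtain rfl := eq_of_heq h
    rfl)

/-- Two test objects for the universal property suffice. The map to `amalgam` gives injectivity and
the overlap; the map to `union` shows that every hyperedge comes from `L` or `C`. -/
theorem isGluing_of_isPushout {a : discrete S X ⟶ L} {c : discrete S X ⟶ C} {f : L ⟶ G}
    {g : C ⟶ G} (ha : Function.Injective a.vmap) (hc : Function.Injective c.vmap)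
    (h : IsPushout a c f g) : IsGluing a c f g := by
  classical
  have glue : ∀ i, f.vmap (a.vmap i) = g.vmap (c.vmap i) := fun i =>
    congrFun (congrArg Hom.vmap h.w) i
  let φ : L.V → C.V ⊕ ↥(Set.range a.vmap)ᶜ := fun x =>
    if hx : x ∈ Set.range a.vmap then Sum.inl (c.vmap hx.choose) else Sum.inr ⟨x, hx⟩
  have hφa : ∀ i, φ (a.vmap i) = Sum.inl (c.vmap i) := by
    intro i
    have hi : a.vmap i ∈ Set.range a.vmap := ⟨i, rfl⟩
    have : hi.choose = i := ha hi.choose_spec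
    simp only [φ, dif_pos hi, this]
  have hφn : ∀ x (hx : x ∉ Set.range a.vmap), φ x = Sum.inr ⟨x, hx⟩ := fun x hx => dif_neg hx
  have hφo : ∀ x v, φ x = Sum.inl v → ∃ i, a.vmap i = x ∧ c.vmap i = v := by
    intro x v hxv
    by_cases hx : x ∈ Set.range a.vmap
    · obtain ⟨i, rfl⟩ := hx
      rw [hφa] at hxv
      exact ⟨i, rfl, Sum.inl.inj hxv⟩
    · simp [hφn x hx] at hxv
  have hφi : Function.Injective φ := by
    intro x y hxy
    by_cases hx : x ∈ Set.range a.vmap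
    · obtain ⟨i, rfl⟩ := hx
      rw [hφa] at hxy
      obtain ⟨j, rfl, hj⟩ := hφo _ _ hxy.symm
      rw [hc hj]
    · by_cases hy : y ∈ Set.range a.vmap
      · obtain ⟨i, rfl⟩ := hy
        rw [hφa] at hxy
        obtain ⟨j, rfl, hj⟩ := hφo _ _ hxy
        rw [hc hj]
      · simpa [hφn x hx, hφn y hy] using hxy
  let l : L ⟶ amalgam a C φ := Hom.mk φ (fun _ => Sum.inl) (fun _ _ _ => rfl) (fun _ _ _ => rfl)
  let k : C ⟶ amalgam a C φ :=
    Hom.mk Sum.inl (fun _ => Sum.inr) (fun _ _ _ => rfl) (fun _ _ _ => rfl)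
  have hlk : a ≫ l = c ≫ k :=
    Hom.ext (funext hφa) (funext fun _ => funext fun e => e.elim)
  let d := h.desc l k hlk
  have hl : f ≫ d = l := h.inl_desc _ _ _
  have hk : g ≫ d = k := h.inr_desc _ _ _
  have hlv : ∀ x, d.vmap (f.vmap x) = φ x := fun x => congrFun (congrArg Hom.vmap hl) x
  have hkv : ∀ v, d.vmap (g.vmap v) = Sum.inl v := fun x => congrFun (congrArg Hom.vmap hk) x
  have hle : ∀ o e, d.emap o (f.emap o e) = Sum.inl e := fun o e =>
    congrFun (congrFun (congrArg Hom.emap hl) o) e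
  have hke : ∀ o e, d.emap o (g.emap o e) = Sum.inr e := fun o e =>
    congrFun (congrFun (congrArg Hom.emap hk) o) e
  let f' : L ⟶ union f g := Hom.mk f.vmap (fun o e => ⟨f.emap o e, Or.inl ⟨e, rfl⟩⟩)
    (fun o e i => f.map_src o e i) (fun o e i => f.map_tgt o e i)
  let g' : C ⟶ union f g := Hom.mk g.vmap (fun o e => ⟨g.emap o e, Or.inr ⟨e, rfl⟩⟩)
    (fun o e i => g.map_src o e i) (fun o e i => g.map_tgt o e i)
  let ι : union f g ⟶ G := Hom.mk id (fun _ e => e.1) (fun _ _ _ => rfl) (fun _ _ _ => rfl)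
  have hfg : a ≫ f' = c ≫ g' :=
    Hom.ext (funext glue) (funext fun _ => funext fun e => e.elim)
  -- The inclusion of `union f g` has a section, so it is surjective on hyperedges.
  have hι : h.desc f' g' hfg ≫ ι = 𝟙 G := by
    apply h.hom_ext
    · rw [← Category.assoc, h.inl_desc, Category.comp_id]; rfl
    · rw [← Category.assoc, h.inr_desc, Category.comp_id]; rfl
  refine ⟨fun x y hxy => hφi ?_, fun x y hxy => Sum.inl_injective (β := ↥(Set.range a.vmap)ᶜ) ?_,
    glue, fun x v hxv => hφo x v ?_, fun o => ⟨?_, fun e => ?_⟩⟩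
  · rw [← hlv, ← hlv, hxy]
  · rw [← hkv, ← hkv, hxy]
  · rw [← hlv, ← hkv, hxv]
  · have hd : ∀ e, d.emap o (Sum.elim (f.emap o) (g.emap o) e) = e := by
      rintro (e | e)
      · exact hle o e
      · exact hke o e
    exact Function.LeftInverse.injective hd
  · have he : ((h.desc f' g' hfg).emap o e).1 = e :=
      congrFun (congrFun (congrArg Hom.emap hι) o) e
    rcases ((h.desc f' g' hfg).emap o e).2 with ⟨e', he'⟩ | ⟨e', he'⟩
    · exact ⟨Sum.inl e', he'.trans he⟩
    · exact ⟨Sum.inr e', he'.trans he⟩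

end Pushout

/-! ### Paths in a gluing -/

namespace IsGluing

variable {X : Type} [Finite X] {L R C D E : SigHypergraph S}
  {a : discrete S X ⟶ L} {b : discrete S X ⟶ R} {c : discrete S X ⟶ C}
  {f : L ⟶ D} {g : C ⟶ D} {r : R ⟶ E} {k : C ⟶ E}

theorem step_cases (hD : IsGluing a c f g) {p q : D.V} (h : D.Step p q) :
    (∃ x y, f.vmap x = p ∧ f.vmap y = q ∧ L.Step x y) ∨
      ∃ v w, g.vmap v = p ∧ g.vmap w = q ∧ C.Step v w := by
  obtain ⟨⟨o, e⟩, ⟨i, rfl⟩, ⟨j, rfl⟩⟩ := h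
  obtain ⟨e | e, rfl⟩ := (hD.bijective o).2 e
  · exact Or.inl ⟨_, _, f.map_src o e i, f.map_tgt o e j, ⟨o, e⟩, ⟨i, rfl⟩, ⟨j, rfl⟩⟩
  · exact Or.inr ⟨_, _, g.map_src o e i, g.map_tgt o e j, ⟨o, e⟩, ⟨i, rfl⟩, ⟨j, rfl⟩⟩

/-- The path is cut where it first takes a hyperedge of the context: that node lies in both parts,
hence in the interface. -/
theorem reach_from_left (hD : IsGluing a c f g) {x : L.V} {q : D.V} (h : D.Reach (f.vmap x) q) :
    (∃ y, f.vmap y = q ∧ L.Reach x y) ∨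
      ∃ i, L.Reach x (a.vmap i) ∧ D.Reach (g.vmap (c.vmap i)) q := by
  induction h with
  | refl => exact Or.inl ⟨x, rfl, .refl⟩
  | tail _ hs ih =>
    rcases ih with ⟨y, rfl, hy⟩ | ⟨i, hi, hr⟩
    · rcases hD.step_cases hs with ⟨y', z, hy', rfl, hyz⟩ | ⟨v, w, hv, rfl, -⟩
      · obtain rfl := hD.left_injective hy'
        exact Or.inl ⟨z, rfl, hy.tail hyz⟩
      · obtain ⟨i, rfl, rfl⟩ := hD.overlap _ _ hv.symm
        exact Or.inr ⟨i, hy, hD.glue i ▸ .single hs⟩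
    · exact Or.inr ⟨i, hi, hr.tail hs⟩

theorem reach_to_left (hD : IsGluing a c f g) {y : L.V} {p : D.V} (h : D.Reach p (f.vmap y)) :
    (∃ x, f.vmap x = p ∧ L.Reach x y) ∨
      ∃ i, L.Reach (a.vmap i) y ∧ D.Reach p (g.vmap (c.vmap i)) := by
  induction h using Relation.ReflTransGen.head_induction_on with
  | refl => exact Or.inl ⟨y, rfl, .refl⟩
  | head hs _ ih =>
    rcases ih with ⟨x, rfl, hx⟩ | ⟨i, hi, hr⟩
    · rcases hD.step_cases hs with ⟨z, x', rfl, hx', hzx⟩ | ⟨v, w, rfl, hw, -⟩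
      · obtain rfl := hD.left_injective hx'
        exact Or.inl ⟨z, rfl, hx.head hzx⟩
      · obtain ⟨i, rfl, rfl⟩ := hD.overlap _ _ hw.symm
        exact Or.inr ⟨i, hx, hD.glue i ▸ .single hs⟩
    · exact Or.inr ⟨i, hi, hr.head hs⟩

/-- Each excursion into `L` starts and ends at interface nodes, so `hI` replaces it by one into `R`.
-/
theorem reach_context (hD : IsGluing a c f g) (hE : IsGluing b c r k)
    (hI : ∀ i j, L.Reach (a.vmap i) (a.vmap j) → R.Reach (b.vmap i) (b.vmap j)) {v w : C.V}
    (h : D.Reach (g.vmap v) (g.vmap w)) : E.Reach (k.vmap v) (k.vmap w) := by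
  have cross : ∀ i j, L.Reach (a.vmap i) (a.vmap j) →
      E.Reach (k.vmap (c.vmap i)) (k.vmap (c.vmap j)) := fun i j hij => by
    rw [← hE.glue, ← hE.glue]
    exact (hI i j hij).map r
  -- The right alternative describes an unfinished excursion, which entered `L` at the interface
  -- node `i` and is now at `y`.
  have key : ∀ q, D.Reach (g.vmap v) q →
      (∃ w, g.vmap w = q ∧ E.Reach (k.vmap v) (k.vmap w)) ∨
        ∃ y i, f.vmap y = q ∧ E.Reach (k.vmap v) (k.vmap (c.vmap i)) ∧ L.Reach (a.vmap i) y := by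
    intro q hq
    induction hq with
    | refl => exact Or.inl ⟨v, rfl, .refl⟩
    | tail _ hs ih =>
      rcases ih with ⟨u, rfl, hu⟩ | ⟨y, i, rfl, hi, hy⟩
      · rcases hD.step_cases hs with ⟨x, y, hx, rfl, hxy⟩ | ⟨u', w, hu', rfl, huw⟩
        · obtain ⟨i, rfl, rfl⟩ := hD.overlap _ _ hx
          exact Or.inr ⟨y, i, rfl, hu, .single hxy⟩
        · obtain rfl := hD.right_injective hu'
          exact Or.inl ⟨w, rfl, hu.tail (huw.map k)⟩
      · rcases hD.step_cases hs with ⟨y', z, hy', rfl, hyz⟩ | ⟨u, w, hu, rfl, huw⟩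
        · obtain rfl := hD.left_injective hy'
          exact Or.inr ⟨z, i, rfl, hi, hy.tail hyz⟩
        · obtain ⟨j, rfl, rfl⟩ := hD.overlap _ _ hu.symm
          exact Or.inl ⟨w, rfl, (hi.trans (cross i j hy)).tail (huw.map k)⟩
  rcases key _ h with ⟨w', hw, h'⟩ | ⟨y, i, hy, hi, h'⟩
  · exact hD.right_injective hw ▸ h'
  · obtain ⟨j, rfl, rfl⟩ := hD.overlap _ _ hy
    exact hi.trans (cross i j h')

theorem reach_interface (hD : IsGluing a c f g) (hE : IsGluing b c r k)
    (hI : ∀ i j, L.Reach (a.vmap i) (a.vmap j) → R.Reach (b.vmap i) (b.vmap j)) {i j : X}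
    (h : D.Reach (f.vmap (a.vmap i)) (f.vmap (a.vmap j))) :
    E.Reach (r.vmap (b.vmap i)) (r.vmap (b.vmap j)) := by
  rw [hD.glue, hD.glue] at h
  rw [hE.glue, hE.glue]
  exact hD.reach_context hE hI h

/-- The bijection between the hyperedges of two gluings with the same context induced by one
between the hyperedges of the patterns. -/
noncomputable def edgeEquiv (hD : IsGluing a c f g) (hE : IsGluing b c r k)
    (σ : ∀ o, L.E o ≃ R.E o) (o : S.Op) : D.E o ≃ E.E o :=
  (Equiv.ofBijective _ (hD.bijective o)).symm.trans
    (((σ o).sumCongr (Equiv.refl _)).trans (Equiv.ofBijective _ (hE.bijective o)))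

theorem edgeEquiv_left (hD : IsGluing a c f g) (hE : IsGluing b c r k)
    (σ : ∀ o, L.E o ≃ R.E o) (o : S.Op) (e : L.E o) :
    hD.edgeEquiv hE σ o (f.emap o e) = r.emap o (σ o e) := by
  have : (Equiv.ofBijective _ (hD.bijective o)).symm (f.emap o e) = Sum.inl e :=
    (Equiv.symm_apply_eq _).2 rfl
  simp [edgeEquiv, this]

theorem edgeEquiv_right (hD : IsGluing a c f g) (hE : IsGluing b c r k)
    (σ : ∀ o, L.E o ≃ R.E o) (o : S.Op) (e : C.E o) :
    hD.edgeEquiv hE σ o (g.emap o e) = k.emap o e := by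
  have : (Equiv.ofBijective _ (hD.bijective o)).symm (g.emap o e) = Sum.inr e :=
    (Equiv.symm_apply_eq _).2 rfl
  simp [edgeEquiv, this]

end IsGluing

end SigHypergraph

/-! ### Linked pairs and simulations of patterns -/

namespace FrobeniusSemialgebra

/-- The first target of a hyperedge. -/
def firstTgt (G : SigHypergraph sig) : ∀ {o : Gen}, G.E o → G.V
  | .mu, e => G.tgt .mu e 0
  | .delta, e => G.tgt .delta e 0

/-- The first source of a hyperedge. -/
def firstSrc (G : SigHypergraph sig) : ∀ {o : Gen}, G.E o → G.V
  | .mu, e => G.src .mu e 0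
  | .delta, e => G.src .delta e 0

theorem map_firstTgt {G H : SigHypergraph sig} (f : G ⟶ H) {o : Gen} (e : G.E o) :
    firstTgt H (f.emap o e) = f.vmap (firstTgt G e) := by
  cases o <;> exact (f.map_tgt _ e 0).symm

theorem map_firstSrc {G H : SigHypergraph sig} (f : G ⟶ H) {o : Gen} (e : G.E o) :
    firstSrc H (f.emap o e) = f.vmap (firstSrc G e) := by
  cases o <;> exact (f.map_src _ e 0).symm

/-- The pairs of an `o`-hyperedge and an `o'`-hyperedge such that the first source of the latter is
reachable from the first target of the former. -/
def linked (G : SigHypergraph sig) (o o' : Gen) : Set (G.E o × G.E o') :=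
  {p | G.Reach (firstTgt G p.1) (firstSrc G p.2)}

instance (G : SigHypergraph sig) (o : Gen) : Finite (G.E o) :=
  haveI : Finite G.Hyperedge := G.finite_E
  Finite.of_injective (β := G.Hyperedge) (fun e => ⟨o, e⟩) sigma_mk_injective

variable {X : Type} [Finite X] {L R C D E : SigHypergraph sig}
  {a : discrete sig X ⟶ L} {b : discrete sig X ⟶ R} {c : discrete sig X ⟶ C}
  {f : L ⟶ D} {g : C ⟶ D} {r : R ⟶ E} {k : C ⟶ E}

/-- Under the bijection `σ` between the hyperedges of two patterns with the same interface, every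
path between interface nodes, first targets of `o`-hyperedges and first sources of `o'`-hyperedges
in the first pattern has a counterpart in the second one. -/
structure Simulates (a : discrete sig X ⟶ L) (b : discrete sig X ⟶ R) (σ : ∀ o, L.E o ≃ R.E o)
    (o o' : Gen) : Prop where
  cross : ∀ i j, L.Reach (a.vmap i) (a.vmap j) → R.Reach (b.vmap i) (b.vmap j)
  exit : ∀ (e : L.E o) i, L.Reach (firstTgt L e) (a.vmap i) →
    R.Reach (firstTgt R (σ o e)) (b.vmap i)
  enter : ∀ i (e : L.E o'), L.Reach (a.vmap i) (firstSrc L e) →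
    R.Reach (b.vmap i) (firstSrc R (σ o' e))
  inner : ∀ (e : L.E o) (e' : L.E o'), L.Reach (firstTgt L e) (firstSrc L e') →
    R.Reach (firstTgt R (σ o e)) (firstSrc R (σ o' e'))

/-- Each of the two hyperedges lies in the pattern or in the context. A linking path is cut at its
first exit from the pattern and its last entry into it, and the pieces are translated separately. -/
theorem Simulates.linked_mono {σ : ∀ o, L.E o ≃ R.E o} {o o' : Gen} (h : Simulates a b σ o o')
    (hD : IsGluing a c f g) (hE : IsGluing b c r k) {p : D.E o × D.E o'} (hp : p ∈ linked D o o') :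
    (hD.edgeEquiv hE σ o).prodCongr (hD.edgeEquiv hE σ o') p ∈ linked E o o' := by
  obtain ⟨p, q⟩ := p
  change E.Reach (firstTgt E (hD.edgeEquiv hE σ o p)) (firstSrc E (hD.edgeEquiv hE σ o' q))
  change D.Reach (firstTgt D p) (firstSrc D q) at hp
  have ctx {v w : C.V} (h' : D.Reach (g.vmap v) (g.vmap w)) : E.Reach (k.vmap v) (k.vmap w) :=
    hD.reach_context hE h.cross h'
  have exit (e : L.E o) (i : X) (h' : L.Reach (firstTgt L e) (a.vmap i)) :
      E.Reach (r.vmap (firstTgt R (σ o e))) (k.vmap (c.vmap i)) := by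
    rw [← hE.glue]; exact (h.exit e i h').map r
  have enter (i : X) (e : L.E o') (h' : L.Reach (a.vmap i) (firstSrc L e)) :
      E.Reach (k.vmap (c.vmap i)) (r.vmap (firstSrc R (σ o' e))) := by
    rw [← hE.glue]; exact (h.enter i e h').map r
  obtain ⟨e | e, rfl⟩ := (hD.bijective o).2 p <;> obtain ⟨e' | e', rfl⟩ := (hD.bijective o').2 q <;>
    simp only [Sum.elim_inl, Sum.elim_inr, IsGluing.edgeEquiv_left, IsGluing.edgeEquiv_right,
      map_firstTgt, map_firstSrc] at hp ⊢
  · rcases hD.reach_from_left hp with ⟨y, hy, h'⟩ | ⟨i, hi, h'⟩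
    · obtain rfl := hD.left_injective hy
      exact (h.inner e e' h').map r
    · rcases hD.reach_to_left h' with ⟨x, hx, h''⟩ | ⟨j, hj, h''⟩
      · rw [← hD.glue] at hx
        obtain rfl := hD.left_injective hx
        exact (h.inner e e' (hi.trans h'')).map r
      · exact ((exit e i hi).trans (ctx h'')).trans (enter j e' hj)
  · rcases hD.reach_from_left hp with ⟨y, hy, h'⟩ | ⟨i, hi, h'⟩
    · obtain ⟨i, rfl, hi⟩ := hD.overlap _ _ hy
      exact hi ▸ exit e i h'
    · exact (exit e i hi).trans (ctx h')
  · rcases hD.reach_to_left hp with ⟨x, hx, h'⟩ | ⟨j, hj, h'⟩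
    · obtain ⟨i, rfl, hi⟩ := hD.overlap _ _ hx
      exact hi ▸ enter i e' h'
    · exact (ctx h').trans (enter j e' hj)
  · exact ctx hp

theorem Simulates.ncard_linked_le {σ : ∀ o, L.E o ≃ R.E o} {o o' : Gen}
    (h : Simulates a b σ o o') (hD : IsGluing a c f g) (hE : IsGluing b c r k) :
    (linked D o o').ncard ≤ (linked E o o').ncard :=
  Set.ncard_le_ncard_of_injOn _ (fun _ hp => h.linked_mono hD hE hp) (Equiv.injective _).injOn

/-- The pair `(e, e')` becomes linked. Its being unlinked before is required in `D`, not just in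
`L`, because a link may run through the context. -/
theorem Simulates.ncard_linked_lt {σ : ∀ o, L.E o ≃ R.E o} {o o' : Gen}
    (h : Simulates a b σ o o') (hD : IsGluing a c f g) (hE : IsGluing b c r k) (e : L.E o)
    (e' : L.E o') (hR : R.Reach (firstTgt R (σ o e)) (firstSrc R (σ o' e')))
    (hL : ¬ D.Reach (f.vmap (firstTgt L e)) (f.vmap (firstSrc L e'))) :
    (linked D o o').ncard < (linked E o o').ncard := by
  rw [← Set.ncard_image_of_injective (linked D o o')
    ((hD.edgeEquiv hE σ o).prodCongr (hD.edgeEquiv hE σ o')).injective]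
  refine Set.ncard_lt_ncard ?_ (Set.toFinite _)
  refine (Set.ssubset_iff_of_subset ?_).2
    ⟨(hD.edgeEquiv hE σ o).prodCongr (hD.edgeEquiv hE σ o') (f.emap o e, f.emap o' e'), ?_, ?_⟩
  · rintro _ ⟨p, hp, rfl⟩
    exact h.linked_mono hD hE hp
  · simp only [linked, Set.mem_ofPred_eq, Equiv.prodCongr_apply, Prod.map, IsGluing.edgeEquiv_left,
      map_firstTgt, map_firstSrc]
    exact hR.map r
  · rw [Function.Injective.mem_set_image (Equiv.injective _)]
    simpa only [linked, Set.mem_ofPred_eq, map_firstTgt, map_firstSrc] using hL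

/-! ### Decidable reachability in the patterns -/

section Concrete

variable {n p q : ℕ} {mus : Fin p → Fin n × Fin n × Fin n} {deltas : Fin q → Fin n × Fin n × Fin n}

/-- The step relation of `graph n mus deltas`. -/
def GraphStep (mus : Fin p → Fin n × Fin n × Fin n) (deltas : Fin q → Fin n × Fin n × Fin n)
    (x y : Fin n) : Prop :=
  (∃ e, ((mus e).1 = x ∨ (mus e).2.1 = x) ∧ (mus e).2.2 = y) ∨
    ∃ e, (deltas e).1 = x ∧ ((deltas e).2.1 = y ∨ (deltas e).2.2 = y)

instance (x y : Fin n) : Decidable (GraphStep mus deltas x y) := by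
  unfold GraphStep; infer_instance

/-- Reachability by at most two steps in `graph n mus deltas`. -/
def GraphReach (mus : Fin p → Fin n × Fin n × Fin n) (deltas : Fin q → Fin n × Fin n × Fin n)
    (x y : Fin n) : Prop :=
  x = y ∨ GraphStep mus deltas x y ∨ ∃ z, GraphStep mus deltas x z ∧ GraphStep mus deltas z y

instance (x y : Fin n) : Decidable (GraphReach mus deltas x y) := by
  unfold GraphReach; infer_instance

theorem step_graph_iff {x y : Fin n} :
    (graph n mus deltas).Step x y ↔ GraphStep mus deltas x y := by
  constructor
  · rintro ⟨⟨_ | _, e⟩, ⟨i, rfl⟩, ⟨j, rfl⟩⟩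
    · refine Or.inl ⟨e, ?_, ?_⟩
      · change Fin 2 at i
        fin_cases i
        · exact Or.inl rfl
        · exact Or.inr rfl
      · change Fin 1 at j
        fin_cases j
        rfl
    · refine Or.inr ⟨e, ?_, ?_⟩
      · change Fin 1 at i
        fin_cases i
        rfl
      · change Fin 2 at j
        fin_cases j
        · exact Or.inl rfl
        · exact Or.inr rfl
  · rintro (⟨e, h | h, h'⟩ | ⟨e, h, h' | h'⟩)
    · exact ⟨⟨.mu, e⟩, ⟨(0 : Fin 2), h⟩, ⟨(0 : Fin 1), h'⟩⟩
    · exact ⟨⟨.mu, e⟩, ⟨(1 : Fin 2), h⟩, ⟨(0 : Fin 1), h'⟩⟩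
    · exact ⟨⟨.delta, e⟩, ⟨(0 : Fin 1), h⟩, ⟨(0 : Fin 2), h'⟩⟩
    · exact ⟨⟨.delta, e⟩, ⟨(0 : Fin 1), h⟩, ⟨(1 : Fin 2), h'⟩⟩

/-- The patterns of FS have two hyperedges each, so two steps suffice; `h` expresses this as a
decidable closure condition. -/
theorem reach_graph_iff
    (h : ∀ x y z, GraphReach mus deltas x y → GraphStep mus deltas y z → GraphReach mus deltas x z)
    {x y : Fin n} : (graph n mus deltas).Reach x y ↔ GraphReach mus deltas x y := by
  constructor
  · intro hxy
    induction hxy with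
    | refl => exact Or.inl rfl
    | tail _ hs ih => exact h _ _ _ ih (step_graph_iff.1 hs)
  · rintro (rfl | hxy | ⟨z, hxz, hzy⟩)
    · exact .refl
    · exact .single (step_graph_iff.2 hxy)
    · exact (Relation.ReflTransGen.single (step_graph_iff.2 hxz)).tail (step_graph_iff.2 hzy)

theorem not_isSource_graph {x : Fin n} (h : ∀ e, (mus e).1 ≠ x ∧ (mus e).2.1 ≠ x)
    (h' : ∀ e, (deltas e).1 ≠ x) (e : (graph n mus deltas).Hyperedge) :
    ¬ (graph n mus deltas).IsSource x e := by
  rcases e with ⟨_ | _, e⟩ <;> rintro ⟨i, hi⟩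
  · change Fin 2 at i
    fin_cases i
    · exact (h e).1 hi
    · exact (h e).2 hi
  · change Fin 1 at i
    fin_cases i
    exact h' e hi

end Concrete

/-- The family of permutations of the hyperedges of `graph n mus deltas` given by its components. -/
def permFamily {n p q : ℕ} {mus mus' : Fin p → Fin n × Fin n × Fin n}
    {deltas deltas' : Fin q → Fin n × Fin n × Fin n} (σ : Equiv.Perm (Fin p))
    (τ : Equiv.Perm (Fin q)) : ∀ o, (graph n mus deltas).E o ≃ (graph n mus' deltas').E o
  | .mu => σ
  | .delta => τ

instance {n p q : ℕ} {mus : Fin p → Fin n × Fin n × Fin n}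
    {deltas : Fin q → Fin n × Fin n × Fin n} : ∀ o, Fintype ((graph n mus deltas).E o)
  | .mu => inferInstanceAs (Fintype (Fin p))
  | .delta => inferInstanceAs (Fintype (Fin q))

section Concrete

variable {n p q s t : ℕ} {mus mus' : Fin p → Fin n × Fin n × Fin n}
  {deltas deltas' : Fin q → Fin n × Fin n × Fin n} {ins : Fin s → Fin n} {outs : Fin t → Fin n}

/-- The first target of a hyperedge of `graph n mus deltas`, as an element of `Fin n`. -/
def graphTgt (mus : Fin p → Fin n × Fin n × Fin n) (deltas : Fin q → Fin n × Fin n × Fin n)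
    {o : Gen} (e : (graph n mus deltas).E o) : Fin n :=
  firstTgt (graph n mus deltas) e

/-- The first source of a hyperedge of `graph n mus deltas`, as an element of `Fin n`. -/
def graphSrc (mus : Fin p → Fin n × Fin n × Fin n) (deltas : Fin q → Fin n × Fin n × Fin n)
    {o : Gen} (e : (graph n mus deltas).E o) : Fin n :=
  firstSrc (graph n mus deltas) e

theorem simulates_graph {σ : Equiv.Perm (Fin p)} {τ : Equiv.Perm (Fin q)} {o o' : Gen}
    (hL : ∀ x y z, GraphReach mus deltas x y → GraphStep mus deltas y z →
      GraphReach mus deltas x z)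
    (hR : ∀ x y z, GraphReach mus' deltas' x y → GraphStep mus' deltas' y z →
      GraphReach mus' deltas' x z)
    (cross : ∀ i j, GraphReach mus deltas (Sum.elim ins outs i) (Sum.elim ins outs j) →
      GraphReach mus' deltas' (Sum.elim ins outs i) (Sum.elim ins outs j))
    (exit : ∀ (e : (graph n mus deltas).E o) i,
      GraphReach mus deltas (graphTgt mus deltas e) (Sum.elim ins outs i) →
      GraphReach mus' deltas' (graphTgt mus' deltas' (permFamily σ τ o e))
        (Sum.elim ins outs i))
    (enter : ∀ i (e : (graph n mus deltas).E o'),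
      GraphReach mus deltas (Sum.elim ins outs i) (graphSrc mus deltas e) →
      GraphReach mus' deltas' (Sum.elim ins outs i)
        (graphSrc mus' deltas' (permFamily σ τ o' e)))
    (inner : ∀ (e : (graph n mus deltas).E o) (e' : (graph n mus deltas).E o'),
      GraphReach mus deltas (graphTgt mus deltas e)
        (graphSrc mus deltas e') →
      GraphReach mus' deltas' (graphTgt mus' deltas' (permFamily σ τ o e))
        (graphSrc mus' deltas' (permFamily σ τ o' e'))) :
    Simulates (boundary ins outs : discrete sig (Fin s ⊕ Fin t) ⟶ graph n mus deltas)
      (boundary ins outs : discrete sig (Fin s ⊕ Fin t) ⟶ graph n mus' deltas')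
      (permFamily σ τ) o o' where
  cross i j h := (reach_graph_iff hR).2 (cross i j ((reach_graph_iff hL).1 h))
  exit e i h := (reach_graph_iff hR).2 (exit e i ((reach_graph_iff hL).1 h))
  enter i e h := (reach_graph_iff hR).2 (enter i e ((reach_graph_iff hL).1 h))
  inner e e' h := (reach_graph_iff hR).2 (inner e e' ((reach_graph_iff hL).1 h))

end Concrete

/-! ### The four rules -/

/-- On the right, node `4` is the target of `μ` and the source of `δ`; every input reaches it and it
reaches every output. -/
theorem simulates_frob₁ : Simulates frob₁.left frob₁.right
    (permFamily (Equiv.refl _) (Equiv.refl _)) .mu .delta :=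
  simulates_graph (by decide) (by decide) (by decide) (by decide) (by decide) (by decide)

theorem simulates_frob₂ : Simulates frob₂.left frob₂.right
    (permFamily (Equiv.refl _) (Equiv.refl _)) .mu .delta :=
  simulates_graph (by decide) (by decide) (by decide) (by decide) (by decide) (by decide)

theorem simulates_assoc_mu_delta : Simulates assoc.left assoc.right
    (permFamily (Equiv.swap 0 1) (Equiv.refl _)) .mu .delta :=
  simulates_graph (by decide) (by decide) (by decide) (by decide) (by decide) (by decide)

/-- The swap pairs the inner product of one side with the outer product of the other. The identity
would fail: it sends first source `1` to first source `0`, which input `1` does not reach. -/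
theorem simulates_assoc_symm_mu_mu : Simulates assoc.right assoc.left
    (permFamily (Equiv.swap 0 1) (Equiv.refl _)) .mu .mu :=
  simulates_graph (by decide) (by decide) (by decide) (by decide) (by decide) (by decide)

theorem simulates_assoc_symm_delta_delta : Simulates assoc.right assoc.left
    (permFamily (Equiv.swap 0 1) (Equiv.refl _)) .delta .delta :=
  simulates_graph (by decide) (by decide) (by decide) (by decide) (by decide) (by decide)

theorem simulates_coassoc_mu_delta : Simulates coassoc.left coassoc.right
    (permFamily (Equiv.refl _) (Equiv.swap 0 1)) .mu .delta :=
  simulates_graph (by decide) (by decide) (by decide) (by decide) (by decide) (by decide)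

theorem simulates_coassoc_symm_mu_mu : Simulates coassoc.right coassoc.left
    (permFamily (Equiv.refl _) (Equiv.swap 0 1)) .mu .mu :=
  simulates_graph (by decide) (by decide) (by decide) (by decide) (by decide) (by decide)

/-- The swap is needed here too: the identity would send first target `2` to first target `1`, which
does not reach output `2`. -/
theorem simulates_coassoc_symm_delta_delta : Simulates coassoc.right coassoc.left
    (permFamily (Equiv.refl _) (Equiv.swap 0 1)) .delta .delta :=
  simulates_graph (by decide) (by decide) (by decide) (by decide) (by decide) (by decide)

/-! ### The decreasing weight -/

/-- The number of pairs of a `μ` and a `δ` which are not linked, followed by the number of linked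
pairs of hyperedges with equal labels. -/
noncomputable def weight (G : SigHypergraph sig) : ℕ ×ₗ ℕ :=
  toLex (Nat.card (G.E .mu) * Nat.card (G.E .delta) - (linked G .mu .delta).ncard,
    (linked G .mu .mu).ncard + (linked G .delta .delta).ncard)

theorem ncard_linked_le_mul (G : SigHypergraph sig) (o o' : Gen) :
    (linked G o o').ncard ≤ Nat.card (G.E o) * Nat.card (G.E o') := by
  rw [← Nat.card_prod]
  exact Set.ncard_le_card _

theorem weight_lt_of_linked_lt {G H : SigHypergraph sig} (e : ∀ o, G.E o ≃ H.E o)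
    (h : (linked G .mu .delta).ncard < (linked H .mu .delta).ncard) : weight H < weight G := by
  -- This bound keeps the truncated subtraction strictly monotone.
  have hH := ncard_linked_le_mul H .mu .delta
  rw [weight, weight, Nat.card_congr (e .mu), Nat.card_congr (e .delta), Prod.Lex.toLex_lt_toLex]
  left
  dsimp only
  omega

theorem weight_lt_of_linked_le {G H : SigHypergraph sig} (e : ∀ o, G.E o ≃ H.E o)
    (h : (linked G .mu .delta).ncard ≤ (linked H .mu .delta).ncard)
    (h' : (linked H .mu .mu).ncard + (linked H .delta .delta).ncard <
      (linked G .mu .mu).ncard + (linked G .delta .delta).ncard) : weight H < weight G := by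
  rw [weight, weight, Nat.card_congr (e .mu), Nat.card_congr (e .delta), Prod.Lex.toLex_lt_toLex]
  dsimp only
  omega

theorem weight_lt_of_convexRewrites {n m : ℕ} {D E : InterfacedHypergraph sig n m}
    (h : ConvexRewrites FS D E) : weight E.graph < weight D.graph := by
  obtain ⟨ρ, hρ, C, f, c, g, r, k, d, ⟨-, hconv⟩, hbc, hE, -⟩ := h
  have hc : Function.Injective c.vmap :=
    haveI := hbc.mono_boundary
    injective_of_mono c
  have hD := hbc.isPushout
  have no_path {x y : ρ.L.V} (hi : Function.Injective f.vmap) (hxy : x ≠ y)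
      (hx : ∀ h, ¬ ρ.L.IsSource x h) : ¬ D.graph.Reach (f.vmap x) (f.vmap y) :=
    not_reach_of_isConvex_image hi hconv hxy hx
  rcases hρ with rfl | rfl | rfl | rfl
  · have ha : Function.Injective (Sum.elim ![0, 1, 2] ![3] : Fin 3 ⊕ Fin 1 → Fin 5) := by decide
    replace hD := isGluing_of_isPushout ha hc hD
    replace hE := isGluing_of_isPushout ha hc hE
    refine weight_lt_of_linked_le (hD.edgeEquiv hE (permFamily (Equiv.swap 0 1) (Equiv.refl _)))
      (simulates_assoc_mu_delta.ncard_linked_le hD hE)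
      (add_lt_add_of_lt_of_le ?_ (simulates_assoc_symm_delta_delta.ncard_linked_le hE hD))
    -- The pair `(1, 0)` of the right side corresponds to `(0, 1)` on the left, linked by the empty
    -- path at node `4`.
    refine simulates_assoc_symm_mu_mu.ncard_linked_lt hE hD (1 : Fin 2) (0 : Fin 2) .refl
      fun h => ?_
    -- A link in `E` would be a path from output `3` to input `1`. Convexity is known only in `D`,
    -- so the path is carried back there.
    exact no_path hD.left_injective (x := (3 : Fin 5)) (y := (1 : Fin 5))
      (by decide : (3 : Fin 5) ≠ 1) (not_isSource_graph (by decide) (by decide))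
      (hE.reach_interface hD simulates_assoc_symm_mu_mu.cross
        (i := Sum.inr (0 : Fin 1)) (j := Sum.inl (1 : Fin 3)) h)
  · have ha : Function.Injective (Sum.elim ![0] ![1, 2, 3] : Fin 1 ⊕ Fin 3 → Fin 5) := by decide
    replace hD := isGluing_of_isPushout ha hc hD
    replace hE := isGluing_of_isPushout ha hc hE
    refine weight_lt_of_linked_le (hD.edgeEquiv hE (permFamily (Equiv.refl _) (Equiv.swap 0 1)))
      (simulates_coassoc_mu_delta.ncard_linked_le hD hE)
      (add_lt_add_of_le_of_lt (simulates_coassoc_symm_mu_mu.ncard_linked_le hE hD) ?_)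
    refine simulates_coassoc_symm_delta_delta.ncard_linked_lt hE hD (1 : Fin 2) (0 : Fin 2) .refl
      fun h => ?_
    exact no_path hD.left_injective (x := (2 : Fin 5)) (y := (0 : Fin 5))
      (by decide : (2 : Fin 5) ≠ 0) (not_isSource_graph (by decide) (by decide))
      (hE.reach_interface hD simulates_coassoc_symm_delta_delta.cross
        (i := Sum.inr (1 : Fin 3)) (j := Sum.inl (0 : Fin 1)) h)
  · have ha : Function.Injective (Sum.elim ![0, 1] ![2, 3] : Fin 2 ⊕ Fin 2 → Fin 5) := by decide
    replace hD := isGluing_of_isPushout ha hc hD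
    replace hE := isGluing_of_isPushout ha hc hE
    refine weight_lt_of_linked_lt (hD.edgeEquiv hE (permFamily (Equiv.refl _) (Equiv.refl _)))
      (simulates_frob₁.ncard_linked_lt hD hE (0 : Fin 1) (0 : Fin 1) .refl ?_)
    -- Node `3` is the target of `μ` and an output; node `0` is the source of `δ` and an input.
    exact no_path hD.left_injective (x := (3 : Fin 5)) (y := (0 : Fin 5))
      (by decide : (3 : Fin 5) ≠ 0) (not_isSource_graph (by decide) (by decide))
  · have ha : Function.Injective (Sum.elim ![0, 1] ![2, 3] : Fin 2 ⊕ Fin 2 → Fin 5) := by decide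
    replace hD := isGluing_of_isPushout ha hc hD
    replace hE := isGluing_of_isPushout ha hc hE
    refine weight_lt_of_linked_lt (hD.edgeEquiv hE (permFamily (Equiv.refl _) (Equiv.refl _)))
      (simulates_frob₂.ncard_linked_lt hD hE (0 : Fin 1) (0 : Fin 1) .refl ?_)
    exact no_path hD.left_injective (x := (2 : Fin 5)) (y := (1 : Fin 5))
      (by decide : (2 : Fin 5) ≠ 1) (not_isSource_graph (by decide) (by decide))

end FrobeniusSemialgebra

theorem mainTheorem5 (n m : ℕ) :
    IsTerminating (ConvexRewrites (n := n) (m := m) FrobeniusSemialgebra.FS) := by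
  rintro ⟨x, hx⟩
  exact not_strictAnti_of_wellFoundedLT (fun t => FrobeniusSemialgebra.weight (x t).graph)
    (strictAnti_nat_of_succ_lt fun t => FrobeniusSemialgebra.weight_lt_of_convexRewrites (hx t))
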